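/- Let $\{p_k\}_{k\ge 0}$ be the Legendre polynomials, normalised by $\int_{-1}^1 p_k(t)p_\ell(t)\,dt=\delta_{k\ell}$, and let $\Theta(x)=0$ for $x<0$ and $\Theta(x)=1$ for $x\ge 0$. Let $\tilde f(t,s)$ be a complex-valued function that is (jointly real-) analytic on a neighbourhood of $[-1,1]^2$ (in particular, $\tilde f$ may depend on $t$ only), let $f(t,s)=\tilde f(t,s)\,\Theta(t-s)$, and let $$f_{k,\ell}=\int_{-1}^{1}\int_{-1}^{1} f(\tau,\rho)\,p_k(\tau)\,p_\ell(\rho)\,d\rho\,d\tau$$ be its Legendre coefficients. Then the coefficients decay along diagonals asymptotically at the rate $1/\ell$, in the following sense. 1. For every fixed integer $\alpha\ge 0$, $f_{k,\ell}=\mathcal O(1/\ell)$ as $k,\ell\to\infty$ with $|k-\ell|=\alpha$. 2. For every $\alpha\ge 0$ the limit $c_\alpha=\lim_{k,\ell\to\infty,\ |k-\ell|=\alpha}\ \ell\,|f_{k,\ell}|$ exists and is finite; and if $\tilde f(t,t)\neq 0$ for some $t\in[-1,1]$ (for $\tilde f$ depending on $t$ only: if $\tilde f$ does not vanish identically on $[-1,1]$),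 then $c_\alpha>0$ for at least one $\alpha$, so that the rate $1/\ell$ is attained. -/

import Mathlib

open MeasureTheory Filter Topology Asymptotics

/-- The Legendre polynomials with the normalisation `P_n(1) = 1`, through Bonnet's recursion
`(n + 2) P_{n+2} = (2 n + 3) X P_{n+1} - (n + 1) P_n`, `P_0 = 1`, `P_1 = X`. -/
noncomputable def legendreP : ℕ → Polynomial ℝ
  | 0 => 1
  | 1 => Polynomial.X
  | n + 2 =>
      Polynomial.C ((2 * (n : ℝ) + 3) / ((n : ℝ) + 2)) * (Polynomial.X * legendreP (n + 1))
        - Polynomial.C (((n : ℝ) + 1) / ((n : ℝ) + 2)) * legendreP n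

/-- The Legendre polynomial of degree `k` that is orthonormal in `L²(-1, 1)`:
`p_k = √((2 k + 1) / 2) P_k`. -/
noncomputable def legendreOrthonormal (k : ℕ) (t : ℝ) : ℝ :=
  Real.sqrt ((2 * (k : ℝ) + 1) / 2) * (legendreP k).eval t

/-- The Heaviside function `Θ(x)`, with `Θ(0) = 1`. -/
noncomputable def heavisideTheta (x : ℝ) : ℝ := if x < 0 then 0 else 1

/-- The distribution `f(t, s) = F(t, s) Θ(t - s)`. -/
noncomputable def thetaKernel (F : ℝ → ℝ → ℂ) (t s : ℝ) : ℂ :=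
  F t s * ((heavisideTheta (t - s) : ℝ) : ℂ)

/-- The Legendre (Fourier) coefficient
`f_{k,ℓ} = ∫_{-1}^{1} ∫_{-1}^{1} f(τ, ρ) p_k(τ) p_ℓ(ρ) dρ dτ`. -/
noncomputable def legendreCoeff (f : ℝ → ℝ → ℂ) (k l : ℕ) : ℂ :=
  ∫ τ in (-1 : ℝ)..1, ∫ ρ in (-1 : ℝ)..1,
    f τ ρ * ((legendreOrthonormal k τ : ℝ) : ℂ) * ((legendreOrthonormal l ρ : ℝ) : ℂ)

/-- The filter on index pairs `(k, ℓ)` for the limit `k, ℓ → ∞` with `|k - ℓ| = a` fixed. -/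
def alongDiagonal (a : ℕ) : Filter (ℕ × ℕ) :=
  (atTop ×ˢ atTop) ⊓ 𝓟 {q : ℕ × ℕ | |(q.1 : ℤ) - (q.2 : ℤ)| = (a : ℤ)}

/-! Write `g t = F t t` and `m = k - ℓ`. The difference `legendreAnti (n + 1) * p_{n+2} -
legendreAnti n * p_n` is an antiderivative of `p_{n+1}` that vanishes at `-1`, and `legendreAnti n`
behaves like `1 / (2 n)`. Integrating by parts in the inner variable
(`legendreCoeff_thetaKernel_succ`) turns `f_{k,ℓ}` into boundary terms on the diagonal `ρ = τ`,
namely moments `∫ g p_k p_{ℓ±1}` with weights of order `1 / ℓ`, and coefficients of the same kind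
for the kernel `∂F/∂s`. The latter tend to zero by another integration by parts
(`tendsto_legendreCoeff_zero`).

Multiplication by `t` acts on the `p_k` as a Jacobi matrix whose off-diagonal entries tend to `1 /
2`. The moments of a monomial therefore converge along diagonals to those of the limiting Toeplitz
matrix, the cosine coefficients of `g (cos θ)`; Weierstrass approximation extends this to continuous
`g` (`tendsto_legendreMoment`). Hence `ℓ f_{k,ℓ}` tends to half the difference of two cosine
coefficients, which is `sinCoeff g m`. It is odd in `m`, so its norm depends on `|m|` only.

If every `sinCoeff g m` is zero, the same holds for each polynomial multiple of `g`, and by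
approximation for `conj g * g`. With `m = 1` this gives `∫ |g (cos θ)|² sin² θ = 0`, so `g = 0`
(`eqOn_zero_of_sinCoeff_eq_zero`). -/

/-! ### Legendre polynomials: recursion, derivatives, endpoint values. -/

open Polynomial in
theorem legendreP_succ_succ (n : ℕ) :
    ((n : ℝ[X]) + 2) * legendreP (n + 2) =
      (2 * (n : ℝ[X]) + 3) * (X * legendreP (n + 1)) - ((n : ℝ[X]) + 1) * legendreP n := by
  have h : (n : ℝ) + 2 ≠ 0 := by positivity
  have e1 : ((n : ℝ[X]) + 2) * C ((2 * (n : ℝ) + 3) / ((n : ℝ) + 2)) = 2 * (n : ℝ[X]) + 3 := by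
    have : ((n : ℝ[X]) + 2) = C ((n : ℝ) + 2) := by simp [C_ofNat]
    rw [this, ← C_mul, mul_div_cancel₀ _ h]; simp [C_ofNat]
  have e2 : ((n : ℝ[X]) + 2) * C (((n : ℝ) + 1) / ((n : ℝ) + 2)) = (n : ℝ[X]) + 1 := by
    have : ((n : ℝ[X]) + 2) = C ((n : ℝ) + 2) := by simp [C_ofNat]
    rw [this, ← C_mul, mul_div_cancel₀ _ h]; simp
  rw [legendreP]
  linear_combination (X * legendreP (n + 1)) * e1 - legendreP n * e2

open Polynomial in
-- Neither relation closes an induction alone: differentiating Bonnet's recursion and using the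
-- second at `n` gives the first at `n + 1`, which then yields the second.
theorem legendreP_derivative_aux (n : ℕ) :
    derivative (legendreP (n + 1)) =
        X * derivative (legendreP n) + ((n : ℝ[X]) + 1) * legendreP n ∧
      X * derivative (legendreP (n + 1)) =
        derivative (legendreP n) + ((n : ℝ[X]) + 1) * legendreP (n + 1) := by
  induction n with
  | zero => simp [legendreP]
  | succ n ih =>
    obtain ⟨hA, hB⟩ := ih
    have hP := legendreP_succ_succ n
    have hd := congrArg derivative hP
    have h0 : (C ((n : ℝ) + 2) : ℝ[X]) ≠ 0 := by
      rw [Ne, C_eq_zero]; positivity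
    have h2 : ((n : ℝ[X]) + 2) ≠ 0 := by simpa [C_ofNat] using h0
    simp only [derivative_mul, derivative_sub, derivative_add, derivative_natCast,
      derivative_X, derivative_one, derivative_ofNat] at hd
    have hA' : derivative (legendreP (n + 1 + 1)) =
        X * derivative (legendreP (n + 1)) + ((n : ℝ[X]) + 1 + 1) * legendreP (n + 1) := by
      apply mul_left_cancel₀ h2
      linear_combination hd + ((n : ℝ[X]) + 1) * hB
    refine ⟨by push_cast; exact hA', ?_⟩
    push_cast
    linear_combination X * hA' + X * hB - hA - hP

open Polynomial in
theorem derivative_legendreP_sub (n : ℕ) :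
    derivative (legendreP (n + 2)) - derivative (legendreP n) =
      (2 * (n : ℝ[X]) + 3) * legendreP (n + 1) := by
  have h1 := (legendreP_derivative_aux (n + 1)).1
  have h2 := (legendreP_derivative_aux n).2
  push_cast at h1
  linear_combination h1 + h2

theorem legendreP_eval_one_aux (n : ℕ) :
    (legendreP n).eval 1 = 1 ∧ (legendreP (n + 1)).eval 1 = 1 := by
  induction n with
  | zero => simp [legendreP]
  | succ n ih =>
    refine ⟨ih.2, ?_⟩
    have h := congrArg (Polynomial.eval 1) (legendreP_succ_succ n)
    simp [ih.1, ih.2] at h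
    have h0 : (n : ℝ) + 2 ≠ 0 := by positivity
    apply mul_left_cancel₀ h0
    linear_combination h

theorem legendreP_eval_neg_one_aux (n : ℕ) :
    (legendreP n).eval (-1) = (-1) ^ n ∧ (legendreP (n + 1)).eval (-1) = (-1) ^ (n + 1) := by
  induction n with
  | zero => simp [legendreP]
  | succ n ih =>
    refine ⟨ih.2, ?_⟩
    have h := congrArg (Polynomial.eval (-1)) (legendreP_succ_succ n)
    simp [ih.1, ih.2] at h
    have h0 : (n : ℝ) + 2 ≠ 0 := by positivity
    apply mul_left_cancel₀ h0
    rw [h]; ring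

theorem legendreP_eval_one (n : ℕ) : (legendreP n).eval 1 = 1 := (legendreP_eval_one_aux n).1

theorem legendreP_eval_neg_one (n : ℕ) : (legendreP n).eval (-1) = (-1) ^ n :=
  (legendreP_eval_neg_one_aux n).1

theorem integral_legendreP_succ (n : ℕ) :
    ∫ t in (-1 : ℝ)..1, (legendreP (n + 1)).eval t = 0 := by
  have h : ∀ t : ℝ, HasDerivAt
      (fun x => (2 * (n : ℝ) + 3)⁻¹ * ((legendreP (n + 2)).eval x - (legendreP n).eval x))
      ((legendreP (n + 1)).eval t) t := by
    intro t
    have h1 := (((legendreP (n + 2)).hasDerivAt t).sub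
      ((legendreP n).hasDerivAt t)).const_mul (2 * (n : ℝ) + 3)⁻¹
    refine h1.congr_deriv ?_
    have := congrArg (Polynomial.eval t) (derivative_legendreP_sub n)
    simp at this
    rw [this, inv_mul_cancel_left₀ (by positivity)]
  rw [intervalIntegral.integral_eq_sub_of_hasDerivAt (fun t _ => h t)
    ((legendreP (n + 1)).continuous.intervalIntegrable _ _)]
  -- The antiderivative vanishes at both ends, since `P_{n+2}` and `P_n` agree at `1` and at `-1`.
  simp [legendreP_eval_one, legendreP_eval_neg_one, pow_add]

/-! ### Orthogonality and norms. -/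

/-- The `L²(-1, 1)` product of two polynomials. -/
noncomputable def legendreInner (p q : Polynomial ℝ) : ℝ :=
  ∫ t in (-1 : ℝ)..1, p.eval t * q.eval t

theorem legendreInner_comm (p q : Polynomial ℝ) : legendreInner p q = legendreInner q p := by
  simp [legendreInner, mul_comm]

theorem legendreInner_mul_left (r p q : Polynomial ℝ) :
    legendreInner (r * p) q = legendreInner p (r * q) := by
  simp only [legendreInner, Polynomial.eval_mul]
  congr 1; ext t; ring

theorem legendreInner_C_mul (c : ℝ) (p q : Polynomial ℝ) :
    legendreInner p (Polynomial.C c * q) = c * legendreInner p q := by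
  simp only [legendreInner, Polynomial.eval_mul, Polynomial.eval_C]
  rw [← intervalIntegral.integral_const_mul]
  congr 1; ext t; ring

theorem legendreInner_sub (p q r : Polynomial ℝ) :
    legendreInner p (q - r) = legendreInner p q - legendreInner p r := by
  simp only [legendreInner, Polynomial.eval_sub, mul_sub]
  exact intervalIntegral.integral_sub
    (by apply Continuous.intervalIntegrable; fun_prop)
    (by apply Continuous.intervalIntegrable; fun_prop)

theorem legendreInner_succ_succ (p : Polynomial ℝ) (n : ℕ) :
    (n + 2) * legendreInner p (legendreP (n + 2)) =
      (2 * n + 3) * legendreInner p (Polynomial.X * legendreP (n + 1)) -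
        (n + 1) * legendreInner p (legendreP n) := by
  rw [legendreP, legendreInner_sub, legendreInner_C_mul, legendreInner_C_mul]
  field_simp

/-- Multiplication by `X` is symmetric, so the recursion reduces row `m + 2` to rows `m + 1` and
`m`; the induction therefore carries two consecutive rows. -/
theorem legendreInner_eq_zero_aux (m : ℕ) :
    (∀ n, m < n → legendreInner (legendreP m) (legendreP n) = 0) ∧
    (∀ n, m + 1 < n → legendreInner (legendreP (m + 1)) (legendreP n) = 0) := by
  have key : ∀ m n : ℕ, legendreInner (legendreP m) (legendreP (n + 2)) = 0 →
      legendreInner (legendreP m) (legendreP n) = 0 →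
      legendreInner (Polynomial.X * legendreP m) (legendreP (n + 1)) = 0 := by
    intro m n h1 h2
    have h := legendreInner_succ_succ (legendreP m) n
    rw [h1, h2, ← legendreInner_mul_left] at h
    have h0 : (2 * (n : ℝ) + 3) ≠ 0 := by positivity
    apply mul_left_cancel₀ h0
    linear_combination -h
  induction m with
  | zero =>
    have h0 : ∀ n, 0 < n → legendreInner (legendreP 0) (legendreP n) = 0 := by
      intro n hn
      obtain ⟨n, rfl⟩ := Nat.exists_eq_succ_of_ne_zero hn.ne'
      simpa [legendreInner, legendreP] using integral_legendreP_succ n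
    refine ⟨h0, fun n hn => ?_⟩
    obtain ⟨n, rfl⟩ := Nat.exists_eq_add_of_lt hn
    have := key 0 (0 + 1 + n) (h0 _ (by omega)) (h0 _ (by omega))
    simpa [legendreP] using this
  | succ m ih =>
    refine ⟨ih.2, fun n hn => ?_⟩
    obtain ⟨n, rfl⟩ := Nat.exists_eq_add_of_lt hn
    have h1 := key (m + 1) (m + 1 + 1 + n) (ih.2 _ (by omega)) (ih.2 _ (by omega))
    have h2 := legendreInner_succ_succ (legendreP (m + 1 + 1 + n + 1)) m
    rw [legendreInner_comm _ (legendreP m), ih.1 _ (by omega), legendreInner_comm _ (_ * _), h1,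
      legendreInner_comm] at h2
    have h0 : (m : ℝ) + 2 ≠ 0 := by positivity
    apply mul_left_cancel₀ h0
    linear_combination h2

theorem legendreInner_eq_zero {m n : ℕ} (h : m ≠ n) :
    legendreInner (legendreP m) (legendreP n) = 0 := by
  rcases h.lt_or_gt with h | h
  · exact (legendreInner_eq_zero_aux m).1 n h
  · rw [legendreInner_comm]; exact (legendreInner_eq_zero_aux n).1 m h

theorem legendreInner_self_aux (n : ℕ) :
    legendreInner (legendreP n) (legendreP n) = 2 / (2 * n + 1) ∧
      legendreInner (legendreP (n + 1)) (legendreP (n + 1)) = 2 / (2 * (n + 1) + 1) := by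
  induction n with
  | zero =>
    constructor
    · simp [legendreInner, legendreP]; norm_num
    · simp only [legendreInner, legendreP, Polynomial.eval_X, ← pow_two, integral_pow]; norm_num
  | succ n ih =>
    refine ⟨by exact_mod_cast ih.2, ?_⟩
    -- The product of `P_{n+2}` with `X P_{n+1}` is computed twice: `h1` ties it to the norm of
    -- `P_{n+2}`, `h2` to that of `P_{n+1}`.
    have h1 := legendreInner_succ_succ (legendreP (n + 2)) n
    have h2 := legendreInner_succ_succ (legendreP (n + 1)) (n + 1)
    rw [legendreInner_eq_zero (show n + 1 ≠ n + 1 + 2 by omega), ih.2,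
      ← legendreInner_mul_left, legendreInner_comm] at h2
    rw [legendreInner_eq_zero (show n + 2 ≠ n by omega)] at h1
    push_cast at h2 ⊢
    have h3 : legendreInner (legendreP (n + 2)) (Polynomial.X * legendreP (n + 1)) =
        (n + 2) / (2 * n + 5) * (2 / (2 * n + 3)) := by
      field_simp
      field_simp at h2
      linear_combination -h2
    rw [h3] at h1
    rw [mul_zero, sub_zero] at h1
    field_simp at h1
    field_simp
    linear_combination h1

theorem legendreInner_self (n : ℕ) :
    legendreInner (legendreP n) (legendreP n) = 2 / (2 * n + 1) := (legendreInner_self_aux n).1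

/-! ### Orthonormal polynomials: Jacobi entries and antiderivatives. -/

theorem continuous_legendreOrthonormal (k : ℕ) : Continuous (legendreOrthonormal k) := by
  unfold legendreOrthonormal; fun_prop

theorem integral_legendreOrthonormal_mul (k l : ℕ) :
    ∫ t in (-1 : ℝ)..1, legendreOrthonormal k t * legendreOrthonormal l t =
      if k = l then 1 else 0 := by
  have h : ∫ t in (-1 : ℝ)..1, legendreOrthonormal k t * legendreOrthonormal l t =
      Real.sqrt ((2 * (k : ℝ) + 1) / 2) * Real.sqrt ((2 * (l : ℝ) + 1) / 2) *
        legendreInner (legendreP k) (legendreP l) := by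
    rw [legendreInner, ← intervalIntegral.integral_const_mul]
    congr 1; ext t; simp only [legendreOrthonormal]; ring
  rw [h]
  split_ifs with hkl
  · subst hkl
    rw [Real.mul_self_sqrt (by positivity), legendreInner_self]
    field_simp
  · rw [legendreInner_eq_zero hkl, mul_zero]

/-- The off-diagonal entries `a_{n+1}` of the Jacobi matrix of the Legendre polynomials. -/
noncomputable def legendreJacobi (n : ℕ) : ℝ :=
  (n + 1) / (Real.sqrt (2 * n + 1) * Real.sqrt (2 * n + 3))

theorem mul_legendreOrthonormal (n : ℕ) (t : ℝ) :
    t * legendreOrthonormal (n + 1) t = legendreJacobi (n + 1) * legendreOrthonormal (n + 2) t +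
      legendreJacobi n * legendreOrthonormal n t := by
  have h := congrArg (Polynomial.eval t) (legendreP_succ_succ n)
  simp at h
  simp only [legendreOrthonormal, legendreJacobi]
  push_cast
  have e1 : 2 * ((n : ℝ) + 1) + 1 = 2 * n + 3 := by ring
  have e2 : 2 * ((n : ℝ) + 2) + 1 = 2 * n + 5 := by ring
  have e3 : 2 * ((n : ℝ) + 1) + 3 = 2 * n + 5 := by ring
  rw [e1, e2, e3, Real.sqrt_div (by positivity), Real.sqrt_div (by positivity),
    Real.sqrt_div (by positivity)]
  have s1 : Real.sqrt (2 * n + 1) ≠ 0 := by positivity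
  have s3 : Real.sqrt (2 * n + 3) ≠ 0 := by positivity
  have s5 : Real.sqrt (2 * n + 5) ≠ 0 := by positivity
  have q3 : Real.sqrt (2 * n + 3) ^ 2 = 2 * n + 3 := Real.sq_sqrt (by positivity)
  field_simp
  rw [q3]
  linear_combination -h

/-- The antiderivative of `p_n` that vanishes at `-1` is a combination of `p_{n+1}` and `p_{n-1}`
with these coefficients. -/
noncomputable def legendreAnti (n : ℕ) : ℝ :=
  1 / (Real.sqrt (2 * n + 1) * Real.sqrt (2 * n + 3))

theorem hasDerivAt_legendreOrthonormal_sub (n : ℕ) (t : ℝ) :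
    HasDerivAt (fun x => legendreAnti (n + 1) * legendreOrthonormal (n + 2) x -
      legendreAnti n * legendreOrthonormal n x) (legendreOrthonormal (n + 1) t) t := by
  have h := congrArg (Polynomial.eval t) (derivative_legendreP_sub n)
  simp at h
  have h1 := ((((legendreP (n + 2)).hasDerivAt t).const_mul
    (Real.sqrt ((2 * ((n + 2 : ℕ) : ℝ) + 1) / 2))).const_mul (legendreAnti (n + 1))).sub
    ((((legendreP n).hasDerivAt t).const_mul
    (Real.sqrt ((2 * (n : ℝ) + 1) / 2))).const_mul (legendreAnti n))
  refine HasDerivAt.congr_deriv h1 ?_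
  simp only [legendreOrthonormal, legendreAnti]
  push_cast
  have e1 : 2 * ((n : ℝ) + 1) + 1 = 2 * n + 3 := by ring
  have e2 : 2 * ((n : ℝ) + 2) + 1 = 2 * n + 5 := by ring
  have e3 : 2 * ((n : ℝ) + 1) + 3 = 2 * n + 5 := by ring
  rw [e1, e2, e3, Real.sqrt_div (by positivity), Real.sqrt_div (by positivity),
    Real.sqrt_div (by positivity)]
  have s1 : Real.sqrt (2 * n + 1) ≠ 0 := by positivity
  have s3 : Real.sqrt (2 * n + 3) ≠ 0 := by positivity
  have s5 : Real.sqrt (2 * n + 5) ≠ 0 := by positivity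
  have q3 : Real.sqrt (2 * n + 3) ^ 2 = 2 * n + 3 := Real.sq_sqrt (by positivity)
  field_simp
  rw [q3]
  linear_combination h

/-- Removes the boundary term at `-1` in the integration by parts. -/
theorem legendreOrthonormal_sub_neg_one (n : ℕ) :
    legendreAnti (n + 1) * legendreOrthonormal (n + 2) (-1) -
      legendreAnti n * legendreOrthonormal n (-1) = 0 := by
  simp only [legendreOrthonormal, legendreAnti, legendreP_eval_neg_one]
  push_cast
  have e1 : 2 * ((n : ℝ) + 1) + 1 = 2 * n + 3 := by ring
  have e2 : 2 * ((n : ℝ) + 2) + 1 = 2 * n + 5 := by ring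
  have e3 : 2 * ((n : ℝ) + 1) + 3 = 2 * n + 5 := by ring
  rw [e1, e2, e3, Real.sqrt_div (by positivity), Real.sqrt_div (by positivity)]
  have s1 : Real.sqrt (2 * n + 1) ≠ 0 := by positivity
  have s3 : Real.sqrt (2 * n + 3) ≠ 0 := by positivity
  have s5 : Real.sqrt (2 * n + 5) ≠ 0 := by positivity
  field_simp
  ring

theorem tendsto_legendreJacobi : Tendsto legendreJacobi atTop (𝓝 (1 / 2)) := by
  -- The two factors are `(2 n + 3) / (n + 1)` and `(2 n + 1) / (n + 1)`; their product is the
  -- inverse square of the Jacobi entry.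
  have h : Tendsto (fun n : ℕ => ((2 + 1 * (1 / ((n : ℝ) + 1))) * (2 - 1 / ((n : ℝ) + 1))))
      atTop (𝓝 ((2 + 1 * 0) * (2 - 0))) :=
    ((tendsto_one_div_add_atTop_nhds_zero_nat.const_mul 1).const_add 2).mul
      (tendsto_one_div_add_atTop_nhds_zero_nat.const_sub 2)
  have h2 := (h.sqrt).inv₀ (by positivity)
  have e : (Real.sqrt ((2 + 1 * 0) * (2 - 0)))⁻¹ = 1 / 2 := by
    rw [show ((2 + 1 * 0) * (2 - 0) : ℝ) = 2 ^ 2 by norm_num, Real.sqrt_sq (by norm_num)]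
    norm_num
  rw [e] at h2
  refine h2.congr fun n => ?_
  have e2 : (2 + 1 * (1 / ((n : ℝ) + 1))) * (2 - 1 / ((n : ℝ) + 1)) =
      ((2 * n + 1) * (2 * n + 3)) / (n + 1) ^ 2 := by
    field_simp; ring
  rw [e2, Real.sqrt_div (by positivity), Real.sqrt_sq (by positivity), inv_div, legendreJacobi,
    Real.sqrt_mul (by positivity)]

theorem legendreAnti_eq (n : ℕ) : (n + 1) * legendreAnti n = legendreJacobi n := by
  simp [legendreAnti, legendreJacobi, div_eq_mul_inv]

theorem tendsto_legendreAnti : Tendsto legendreAnti atTop (𝓝 0) := by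
  have h := tendsto_legendreJacobi.mul (tendsto_one_div_add_atTop_nhds_zero_nat (𝕜 := ℝ))
  rw [mul_zero] at h
  refine h.congr fun n => ?_
  rw [← legendreAnti_eq]; field_simp

/-! ### Signed diagonals and index shifts. -/

/-- The filter on index pairs `(k, ℓ)` for the limit `k, ℓ → ∞` with `k - ℓ = m` fixed. -/
def alongIntDiagonal (m : ℤ) : Filter (ℕ × ℕ) :=
  (atTop ×ˢ atTop) ⊓ 𝓟 {q : ℕ × ℕ | (q.1 : ℤ) - (q.2 : ℤ) = m}

theorem alongDiagonal_le (a : ℕ) :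
    alongDiagonal a ≤ alongIntDiagonal a ⊔ alongIntDiagonal (-a) := by
  unfold alongDiagonal alongIntDiagonal
  rw [← inf_sup_left, sup_principal]
  refine inf_le_inf_left _ (principal_mono.2 fun q hq => ?_)
  exact (abs_eq (by positivity)).1 hq

theorem tendsto_fst_alongIntDiagonal (m : ℤ) :
    Tendsto Prod.fst (alongIntDiagonal m) atTop :=
  tendsto_fst.mono_left inf_le_left

theorem tendsto_snd_alongIntDiagonal (m : ℤ) :
    Tendsto Prod.snd (alongIntDiagonal m) atTop :=
  tendsto_snd.mono_left inf_le_left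

theorem eventually_alongIntDiagonal (m : ℤ) :
    ∀ᶠ q : ℕ × ℕ in alongIntDiagonal m, (q.1 : ℤ) - (q.2 : ℤ) = m :=
  mem_inf_of_right (mem_principal_self _)

/-- Shifting `ℓ` moves to a neighbouring diagonal. The hypothesis is only eventual because `l - 1`
truncates at `l = 0`. -/
theorem tendsto_alongIntDiagonal_of {m n : ℤ} {u : ℕ → ℕ} (hu : Tendsto u atTop atTop)
    (h : ∀ᶠ l in atTop, (u l : ℤ) = l + (m - n)) :
    Tendsto (fun q : ℕ × ℕ => (q.1, u q.2)) (alongIntDiagonal m) (alongIntDiagonal n) := by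
  refine tendsto_inf.2 ⟨(tendsto_fst_alongIntDiagonal m).prodMk
    (hu.comp (tendsto_snd_alongIntDiagonal m)), tendsto_principal.2 ?_⟩
  filter_upwards [eventually_alongIntDiagonal m,
    (tendsto_snd_alongIntDiagonal m).eventually h] with q h1 h2
  omega

theorem tendsto_succ_alongIntDiagonal (m : ℤ) :
    Tendsto (fun q : ℕ × ℕ => (q.1, q.2 + 1)) (alongIntDiagonal m) (alongIntDiagonal (m - 1)) :=
  tendsto_alongIntDiagonal_of (u := fun l => l + 1) (tendsto_add_atTop_nat 1)
    (Eventually.of_forall fun l => by push_cast; ring)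

theorem tendsto_pred_alongIntDiagonal (m : ℤ) :
    Tendsto (fun q : ℕ × ℕ => (q.1, q.2 - 1)) (alongIntDiagonal m) (alongIntDiagonal (m + 1)) :=
  tendsto_alongIntDiagonal_of (u := fun l => l - 1) (tendsto_sub_atTop_nat 1)
    ((eventually_ge_atTop 1).mono fun l hl => by push_cast [hl]; ring)

theorem tendsto_legendreJacobi_snd (m : ℤ) :
    Tendsto (fun q : ℕ × ℕ => ((legendreJacobi q.2 : ℝ) : ℂ)) (alongIntDiagonal m)
      (𝓝 (1 / 2)) := by
  have := (Complex.continuous_ofReal.tendsto _).comp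
    (tendsto_legendreJacobi.comp (tendsto_snd_alongIntDiagonal m))
  simpa [Function.comp_def] using this

theorem tendsto_legendreJacobi_pred (m : ℤ) :
    Tendsto (fun q : ℕ × ℕ => ((legendreJacobi (q.2 - 1) : ℝ) : ℂ)) (alongIntDiagonal m)
      (𝓝 (1 / 2)) := by
  have := (tendsto_legendreJacobi_snd (m + 1)).comp (tendsto_pred_alongIntDiagonal m)
  exact this

/-! ### Moments along diagonals and their cosine limits. -/

/-- The matrix entry `∫ g p_k p_ℓ` of multiplication by `g`. -/
noncomputable def legendreMoment (g : ℝ → ℂ) (k l : ℕ) : ℂ :=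
  ∫ t in (-1 : ℝ)..1,
    g t * ((legendreOrthonormal k t : ℝ) : ℂ) * ((legendreOrthonormal l t : ℝ) : ℂ)

/-- The cosine coefficient `(1 / π) ∫_0^π g(cos θ) cos (m θ) dθ`. -/
noncomputable def cosCoeff (g : ℝ → ℂ) (m : ℤ) : ℂ :=
  (1 / Real.pi : ℝ) * ∫ θ in (0 : ℝ)..Real.pi, g (Real.cos θ) * ((Real.cos (m * θ) : ℝ) : ℂ)

theorem intervalIntegrable_of_continuousOn_Icc {f : ℝ → ℂ}
    (hf : ContinuousOn f (Set.Icc (-1) 1)) : IntervalIntegrable f volume (-1) 1 :=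
  ContinuousOn.intervalIntegrable (by rwa [Set.uIcc_of_le (by norm_num)])

theorem continuous_legendreOrthonormal_ofReal (k : ℕ) :
    Continuous fun t => ((legendreOrthonormal k t : ℝ) : ℂ) :=
  Complex.continuous_ofReal.comp (continuous_legendreOrthonormal k)

theorem continuousOn_legendreMoment {g : ℝ → ℂ} (hg : ContinuousOn g (Set.Icc (-1) 1))
    (k l : ℕ) : ContinuousOn (fun t => g t * ((legendreOrthonormal k t : ℝ) : ℂ) *
      ((legendreOrthonormal l t : ℝ) : ℂ)) (Set.Icc (-1) 1) :=
  (hg.mul (continuous_legendreOrthonormal_ofReal k).continuousOn).mul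
    (continuous_legendreOrthonormal_ofReal l).continuousOn

theorem continuousOn_comp_cos {g : ℝ → ℂ} (hg : ContinuousOn g (Set.Icc (-1) 1)) :
    Continuous fun θ : ℝ => g (Real.cos θ) :=
  hg.comp_continuous Real.continuous_cos fun θ => ⟨Real.neg_one_le_cos θ, Real.cos_le_one θ⟩

theorem continuous_cosCoeff {g : ℝ → ℂ} (hg : ContinuousOn g (Set.Icc (-1) 1)) (m : ℤ) :
    Continuous fun θ : ℝ => g (Real.cos θ) * ((Real.cos (m * θ) : ℝ) : ℂ) :=
  (continuousOn_comp_cos hg).mul (by fun_prop)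

theorem integral_abs_legendreOrthonormal_mul_le (k l : ℕ) :
    ∫ t in (-1 : ℝ)..1, |legendreOrthonormal k t| * |legendreOrthonormal l t| ≤ 1 := by
  have ck := continuous_legendreOrthonormal k
  have cl := continuous_legendreOrthonormal l
  have h1 := integral_legendreOrthonormal_mul k k
  have h2 := integral_legendreOrthonormal_mul l l
  rw [if_pos rfl] at h1 h2
  have h3 : ∫ t in (-1 : ℝ)..1, (1 / 2 : ℝ) * (legendreOrthonormal k t * legendreOrthonormal k t) +
      (1 / 2) * (legendreOrthonormal l t * legendreOrthonormal l t) = 1 := by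
    rw [intervalIntegral.integral_add (Continuous.intervalIntegrable (by fun_prop) _ _)
      (Continuous.intervalIntegrable (by fun_prop) _ _), intervalIntegral.integral_const_mul,
      intervalIntegral.integral_const_mul, h1, h2]
    norm_num
  refine le_trans (intervalIntegral.integral_mono_on (by norm_num) ?_ ?_ fun t _ => ?_) h3.le
  · exact Continuous.intervalIntegrable (by fun_prop) _ _
  · exact Continuous.intervalIntegrable (by fun_prop) _ _
  nlinarith [sq_nonneg (|legendreOrthonormal k t| - |legendreOrthonormal l t|),
    abs_mul_abs_self (legendreOrthonormal k t), abs_mul_abs_self (legendreOrthonormal l t)]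

/-- Uniformity in `k` and `l` is what lets the limit pass from polynomials to continuous functions.
-/
theorem norm_legendreMoment_le {g : ℝ → ℂ} {C : ℝ} (hC : ∀ t ∈ Set.Icc (-1 : ℝ) 1, ‖g t‖ ≤ C)
    (k l : ℕ) : ‖legendreMoment g k l‖ ≤ C := by
  have ck := continuous_legendreOrthonormal k
  have cl := continuous_legendreOrthonormal l
  have hC0 : 0 ≤ C := (norm_nonneg _).trans (hC 0 (by norm_num))
  have h : ‖legendreMoment g k l‖ ≤
      ∫ t in (-1 : ℝ)..1, C * (|legendreOrthonormal k t| * |legendreOrthonormal l t|) := by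
    refine intervalIntegral.norm_integral_le_of_norm_le (by norm_num) ?_
      (Continuous.intervalIntegrable (by fun_prop) _ _)
    refine Eventually.of_forall fun t ht => ?_
    rw [norm_mul, norm_mul, Complex.norm_real, Complex.norm_real, mul_assoc]
    exact mul_le_mul_of_nonneg_right (hC t (Set.Ioc_subset_Icc_self ht)) (by positivity)
  refine h.trans ?_
  rw [intervalIntegral.integral_const_mul]
  exact mul_le_of_le_one_right hC0 (integral_abs_legendreOrthonormal_mul_le k l)

theorem norm_cosCoeff_le {g : ℝ → ℂ} {C : ℝ} (hC : ∀ t ∈ Set.Icc (-1 : ℝ) 1, ‖g t‖ ≤ C)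
    (m : ℤ) : ‖cosCoeff g m‖ ≤ C := by
  have hC0 : 0 ≤ C := (norm_nonneg _).trans (hC 0 (by norm_num))
  have h : ‖∫ θ in (0 : ℝ)..Real.pi, g (Real.cos θ) * ((Real.cos (m * θ) : ℝ) : ℂ)‖ ≤
      C * |Real.pi - 0| := by
    refine intervalIntegral.norm_integral_le_of_norm_le_const fun θ _ => ?_
    rw [norm_mul, Complex.norm_real]
    calc _ ≤ C * 1 := mul_le_mul (hC _ ⟨Real.neg_one_le_cos θ, Real.cos_le_one θ⟩)
          (Real.abs_cos_le_one _) (abs_nonneg _) hC0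
      _ = C := mul_one C
  rw [cosCoeff, norm_mul, Complex.norm_real, Real.norm_of_nonneg (by positivity)]
  rw [sub_zero, abs_of_pos Real.pi_pos] at h
  calc _ ≤ 1 / Real.pi * (C * Real.pi) := by gcongr
    _ = C := by field_simp

theorem legendreMoment_add {f g : ℝ → ℂ} (hf : ContinuousOn f (Set.Icc (-1) 1))
    (hg : ContinuousOn g (Set.Icc (-1) 1)) (k l : ℕ) :
    legendreMoment (fun t => f t + g t) k l = legendreMoment f k l + legendreMoment g k l := by
  simp only [legendreMoment, add_mul]
  exact intervalIntegral.integral_add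
    (intervalIntegrable_of_continuousOn_Icc (continuousOn_legendreMoment hf k l))
    (intervalIntegrable_of_continuousOn_Icc (continuousOn_legendreMoment hg k l))

theorem legendreMoment_const_mul (c : ℂ) (g : ℝ → ℂ) (k l : ℕ) :
    legendreMoment (fun t => c * g t) k l = c * legendreMoment g k l := by
  simp only [legendreMoment, ← intervalIntegral.integral_const_mul, mul_assoc]

theorem cosCoeff_add {f g : ℝ → ℂ} (hf : ContinuousOn f (Set.Icc (-1) 1))
    (hg : ContinuousOn g (Set.Icc (-1) 1)) (m : ℤ) :
    cosCoeff (fun t => f t + g t) m = cosCoeff f m + cosCoeff g m := by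
  simp only [cosCoeff, add_mul, ← mul_add]
  rw [← intervalIntegral.integral_add ((continuous_cosCoeff hf m).intervalIntegrable _ _)
    ((continuous_cosCoeff hg m).intervalIntegrable _ _)]

theorem cosCoeff_const_mul (c : ℂ) (g : ℝ → ℂ) (m : ℤ) :
    cosCoeff (fun t => c * g t) m = c * cosCoeff g m := by
  simp only [cosCoeff, mul_assoc, intervalIntegral.integral_const_mul]
  ring

theorem legendreMoment_sub {f g : ℝ → ℂ} (hf : ContinuousOn f (Set.Icc (-1) 1))
    (hg : ContinuousOn g (Set.Icc (-1) 1)) (k l : ℕ) :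
    legendreMoment (fun t => f t - g t) k l = legendreMoment f k l - legendreMoment g k l := by
  have h := legendreMoment_add (hf.sub hg) hg k l
  simp only [Pi.sub_apply, sub_add_cancel] at h
  exact eq_sub_of_add_eq h.symm

theorem cosCoeff_sub {f g : ℝ → ℂ} (hf : ContinuousOn f (Set.Icc (-1) 1))
    (hg : ContinuousOn g (Set.Icc (-1) 1)) (m : ℤ) :
    cosCoeff (fun t => f t - g t) m = cosCoeff f m - cosCoeff g m := by
  have h := cosCoeff_add (hf.sub hg) hg m
  simp only [Pi.sub_apply, sub_add_cancel] at h
  exact eq_sub_of_add_eq h.symm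

theorem legendreMoment_one (k l : ℕ) :
    legendreMoment (fun _ => 1) k l = if k = l then 1 else 0 := by
  simp only [legendreMoment, one_mul, ← Complex.ofReal_mul]
  rw [intervalIntegral.integral_ofReal, integral_legendreOrthonormal_mul]
  split_ifs <;> simp

theorem cosCoeff_one (m : ℤ) : cosCoeff (fun _ => 1) m = if m = 0 then 1 else 0 := by
  simp only [cosCoeff, one_mul]
  rw [intervalIntegral.integral_ofReal]
  split_ifs with h
  · subst h
    have := Real.pi_ne_zero
    simp [this]
  · have hm : (m : ℝ) ≠ 0 := by exact_mod_cast h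
    rw [intervalIntegral.integral_comp_mul_left (fun x => Real.cos x) hm, integral_cos]
    simp [Real.sin_int_mul_pi]

theorem legendreMoment_mul_self {g : ℝ → ℂ} (hg : ContinuousOn g (Set.Icc (-1) 1)) (k l : ℕ) :
    legendreMoment (fun t => (t : ℂ) * g t) k (l + 1) =
      legendreJacobi (l + 1) * legendreMoment g k (l + 2) +
        legendreJacobi l * legendreMoment g k l := by
  simp only [legendreMoment]
  rw [← intervalIntegral.integral_const_mul, ← intervalIntegral.integral_const_mul,
    ← intervalIntegral.integral_add]
  · congr 1; ext t
    have h := congrArg (fun x : ℝ => (x : ℂ)) (mul_legendreOrthonormal l t)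
    push_cast at h
    linear_combination (g t * legendreOrthonormal k t) * h
  · exact (intervalIntegrable_of_continuousOn_Icc
      (continuousOn_legendreMoment hg k (l + 2))).const_mul _
  · exact (intervalIntegrable_of_continuousOn_Icc
      (continuousOn_legendreMoment hg k l)).const_mul _

/-- The limiting form of `legendreMoment_mul_self`, with both Jacobi entries replaced by `1 / 2`; it
comes from the product formula for cosines. -/
theorem cosCoeff_mul_self {g : ℝ → ℂ} (hg : ContinuousOn g (Set.Icc (-1) 1)) (m : ℤ) :
    cosCoeff (fun t => (t : ℂ) * g t) m =
      1 / 2 * cosCoeff g (m - 1) + 1 / 2 * cosCoeff g (m + 1) := by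
  have h : ∫ θ in (0 : ℝ)..Real.pi,
      (Real.cos θ : ℂ) * g (Real.cos θ) * ((Real.cos (m * θ) : ℝ) : ℂ) =
      1 / 2 * (∫ θ in (0 : ℝ)..Real.pi,
        g (Real.cos θ) * ((Real.cos (((m - 1 : ℤ) : ℝ) * θ) : ℝ) : ℂ)) +
      1 / 2 * ∫ θ in (0 : ℝ)..Real.pi,
        g (Real.cos θ) * ((Real.cos (((m + 1 : ℤ) : ℝ) * θ) : ℝ) : ℂ) := by
    rw [← intervalIntegral.integral_const_mul, ← intervalIntegral.integral_const_mul,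
      ← intervalIntegral.integral_add]
    · congr 1; ext θ
      have h1 : Real.cos (((m - 1 : ℤ) : ℝ) * θ) =
          Real.cos (m * θ) * Real.cos θ + Real.sin (m * θ) * Real.sin θ := by
        rw [← Real.cos_sub]; push_cast; ring_nf
      have h2 : Real.cos (((m + 1 : ℤ) : ℝ) * θ) =
          Real.cos (m * θ) * Real.cos θ - Real.sin (m * θ) * Real.sin θ := by
        rw [← Real.cos_add]; push_cast; ring_nf
      rw [h1, h2]; push_cast; ring
    · exact ((continuous_cosCoeff hg _).const_mul _).intervalIntegrable _ _
    · exact ((continuous_cosCoeff hg _).const_mul _).intervalIntegrable _ _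
  simp only [cosCoeff]
  rw [h]; ring

theorem tendsto_legendreMoment_mul_self {g : ℝ → ℂ} (hg : ContinuousOn g (Set.Icc (-1) 1))
    (h : ∀ m : ℤ, Tendsto (fun q : ℕ × ℕ => legendreMoment g q.1 q.2) (alongIntDiagonal m)
      (𝓝 (cosCoeff g m))) (m : ℤ) :
    Tendsto (fun q : ℕ × ℕ => legendreMoment (fun t => (t : ℂ) * g t) q.1 q.2)
      (alongIntDiagonal m) (𝓝 (cosCoeff (fun t => (t : ℂ) * g t) m)) := by
  rw [cosCoeff_mul_self hg]
  have h1 := (tendsto_legendreJacobi_snd m).mul ((h (m - 1)).comp (tendsto_succ_alongIntDiagonal m))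
  have h2 := (tendsto_legendreJacobi_pred m).mul
    ((h (m + 1)).comp (tendsto_pred_alongIntDiagonal m))
  refine (h1.add h2).congr' ?_
  filter_upwards [(tendsto_snd_alongIntDiagonal m).eventually (eventually_ge_atTop 1)] with q hq
  obtain ⟨k, l⟩ := q
  obtain ⟨l, rfl⟩ := Nat.exists_eq_add_of_le' hq
  simp [legendreMoment_mul_self hg]

theorem tendsto_legendreMoment_polynomial (p : Polynomial ℂ) (m : ℤ) :
    Tendsto (fun q : ℕ × ℕ => legendreMoment (fun t => p.eval (t : ℂ)) q.1 q.2)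
      (alongIntDiagonal m) (𝓝 (cosCoeff (fun t => p.eval (t : ℂ)) m)) := by
  have hpow : ∀ n : ℕ, ∀ m : ℤ,
      Tendsto (fun q : ℕ × ℕ => legendreMoment (fun t => (t : ℂ) ^ n) q.1 q.2)
        (alongIntDiagonal m) (𝓝 (cosCoeff (fun t => (t : ℂ) ^ n) m)) := by
    intro n
    induction n with
    | zero =>
      intro m
      simp only [pow_zero, cosCoeff_one, legendreMoment_one]
      refine tendsto_const_nhds.congr' ?_
      filter_upwards [eventually_alongIntDiagonal m] with q hq
      have : m = 0 ↔ q.1 = q.2 := by omega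
      simp [this]
    | succ n ih =>
      intro m
      simp only [pow_succ']
      exact tendsto_legendreMoment_mul_self (by fun_prop) ih m
  induction p using Polynomial.induction_on' with
  | add p q hp hq =>
    simp only [Polynomial.eval_add]
    rw [cosCoeff_add (by fun_prop) (by fun_prop)]
    refine (hp.add hq).congr fun x => ?_
    rw [legendreMoment_add (by fun_prop) (by fun_prop)]
  | monomial n c =>
    simp only [Polynomial.eval_monomial, cosCoeff_const_mul, legendreMoment_const_mul]
    exact (hpow n m).const_mul c

theorem exists_complex_polynomial_near {g : ℝ → ℂ} (hg : ContinuousOn g (Set.Icc (-1) 1))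
    {ε : ℝ} (hε : 0 < ε) :
    ∃ p : Polynomial ℂ, ∀ t ∈ Set.Icc (-1 : ℝ) 1, ‖g t - p.eval (t : ℂ)‖ ≤ ε := by
  obtain ⟨p, hp⟩ := exists_polynomial_near_of_continuousOn (-1) 1 (fun t => (g t).re)
    (Complex.continuous_re.comp_continuousOn hg) (ε / 2) (half_pos hε)
  obtain ⟨q, hq⟩ := exists_polynomial_near_of_continuousOn (-1) 1 (fun t => (g t).im)
    (Complex.continuous_im.comp_continuousOn hg) (ε / 2) (half_pos hε)
  refine ⟨p.map Complex.ofRealHom + Polynomial.C Complex.I * q.map Complex.ofRealHom,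
    fun t ht => ?_⟩
  have e : ∀ r : Polynomial ℝ, (r.map Complex.ofRealHom).eval (t : ℂ) = ((r.eval t : ℝ) : ℂ) :=
    fun r => by
      have := Polynomial.eval_map_apply (f := Complex.ofRealHom) (p := r) t
      simpa using this
  have h1 := (hp t ht).le
  have h2 := (hq t ht).le
  refine (Complex.norm_le_abs_re_add_abs_im _).trans ?_
  simp [e]
  rw [abs_sub_comm, abs_sub_comm (g t).im]
  linarith

theorem tendsto_legendreMoment {g : ℝ → ℂ} (hg : ContinuousOn g (Set.Icc (-1) 1)) (m : ℤ) :
    Tendsto (fun q : ℕ × ℕ => legendreMoment g q.1 q.2) (alongIntDiagonal m)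
      (𝓝 (cosCoeff g m)) := by
  rw [Metric.tendsto_nhds]
  intro ε hε
  -- The approximation error enters twice and the polynomial limit once, for a total of `3 ε / 4 <
  -- ε`.
  obtain ⟨p, hp⟩ := exists_complex_polynomial_near hg (show 0 < ε / 4 by positivity)
  have hpc : ContinuousOn (fun t : ℝ => p.eval (t : ℂ)) (Set.Icc (-1) 1) := by fun_prop
  filter_upwards [Metric.tendsto_nhds.1 (tendsto_legendreMoment_polynomial p m) (ε / 4)
    (by positivity)] with q hq
  have h1 := norm_legendreMoment_le hp q.1 q.2
  have h2 := norm_cosCoeff_le hp m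
  rw [legendreMoment_sub hg hpc] at h1
  rw [cosCoeff_sub hg hpc] at h2
  rw [← dist_eq_norm] at h1 h2
  rw [dist_comm] at h2
  have := dist_triangle4 (legendreMoment g q.1 q.2) _ _ (cosCoeff g m) |>.trans
    (add_le_add (add_le_add h1 hq.le) h2)
  linarith

/-! ### Sine coefficients determine the function. -/

/-- The sine coefficient `(1 / π) ∫_0^π g(cos θ) sin θ sin (m θ) dθ`. -/
noncomputable def sinCoeff (g : ℝ → ℂ) (m : ℤ) : ℂ :=
  (1 / Real.pi : ℝ) * ∫ θ in (0 : ℝ)..Real.pi,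
    g (Real.cos θ) * ((Real.sin θ * Real.sin (m * θ) : ℝ) : ℂ)

theorem half_cosCoeff_sub {g : ℝ → ℂ} (hg : ContinuousOn g (Set.Icc (-1) 1)) (m : ℤ) :
    1 / 2 * cosCoeff g (m - 1) - 1 / 2 * cosCoeff g (m + 1) = sinCoeff g m := by
  have h : ∫ θ in (0 : ℝ)..Real.pi, g (Real.cos θ) * ((Real.sin θ * Real.sin (m * θ) : ℝ) : ℂ) =
      1 / 2 * (∫ θ in (0 : ℝ)..Real.pi,
        g (Real.cos θ) * ((Real.cos (((m - 1 : ℤ) : ℝ) * θ) : ℝ) : ℂ)) -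
      1 / 2 * ∫ θ in (0 : ℝ)..Real.pi,
        g (Real.cos θ) * ((Real.cos (((m + 1 : ℤ) : ℝ) * θ) : ℝ) : ℂ) := by
    rw [← intervalIntegral.integral_const_mul, ← intervalIntegral.integral_const_mul,
      ← intervalIntegral.integral_sub]
    · congr 1; ext θ
      have h1 : Real.cos (((m - 1 : ℤ) : ℝ) * θ) =
          Real.cos (m * θ) * Real.cos θ + Real.sin (m * θ) * Real.sin θ := by
        rw [← Real.cos_sub]; push_cast; ring_nf
      have h2 : Real.cos (((m + 1 : ℤ) : ℝ) * θ) =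
          Real.cos (m * θ) * Real.cos θ - Real.sin (m * θ) * Real.sin θ := by
        rw [← Real.cos_add]; push_cast; ring_nf
      rw [h1, h2]; push_cast; ring
    · exact ((continuous_cosCoeff hg _).const_mul _).intervalIntegrable _ _
    · exact ((continuous_cosCoeff hg _).const_mul _).intervalIntegrable _ _
  simp only [cosCoeff, sinCoeff]
  rw [h]; ring

theorem sinCoeff_neg (g : ℝ → ℂ) (m : ℤ) : sinCoeff g (-m) = -sinCoeff g m := by
  simp only [sinCoeff, ← mul_neg, ← intervalIntegral.integral_neg]
  congr 2; ext θ
  simp [neg_mul, Real.sin_neg]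

theorem sinCoeff_mul_self {g : ℝ → ℂ} (hg : ContinuousOn g (Set.Icc (-1) 1)) (m : ℤ) :
    sinCoeff (fun t => (t : ℂ) * g t) m =
      1 / 2 * sinCoeff g (m - 1) + 1 / 2 * sinCoeff g (m + 1) := by
  have ht : ContinuousOn (fun t : ℝ => (t : ℂ) * g t) (Set.Icc (-1) 1) :=
    (by fun_prop : ContinuousOn (fun t : ℝ => (t : ℂ)) _).mul hg
  simp only [← half_cosCoeff_sub hg, ← half_cosCoeff_sub ht, cosCoeff_mul_self hg]
  ring_nf

theorem sinCoeff_pow_mul_eq_zero {g : ℝ → ℂ} (hg : ContinuousOn g (Set.Icc (-1) 1))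
    (h : ∀ m : ℤ, sinCoeff g m = 0) (n : ℕ) (m : ℤ) :
    sinCoeff (fun t => (t : ℂ) ^ n * g t) m = 0 := by
  induction n generalizing m with
  | zero => simpa using h m
  | succ n ih =>
    simp only [pow_succ', mul_assoc]
    have ht : ContinuousOn (fun t : ℝ => (t : ℂ) ^ n * g t) (Set.Icc (-1) 1) :=
      (by fun_prop : ContinuousOn (fun t : ℝ => (t : ℂ) ^ n) _).mul hg
    rw [sinCoeff_mul_self ht, ih, ih]; simp

theorem sinCoeff_add {f g : ℝ → ℂ} (hf : ContinuousOn f (Set.Icc (-1) 1))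
    (hg : ContinuousOn g (Set.Icc (-1) 1)) (m : ℤ) :
    sinCoeff (fun t => f t + g t) m = sinCoeff f m + sinCoeff g m := by
  have h : ContinuousOn (fun t => f t + g t) (Set.Icc (-1) 1) := hf.add hg
  simp only [← half_cosCoeff_sub h, ← half_cosCoeff_sub hf, ← half_cosCoeff_sub hg,
    cosCoeff_add hf hg]
  ring

theorem sinCoeff_polynomial_mul_eq_zero {g : ℝ → ℂ} (hg : ContinuousOn g (Set.Icc (-1) 1))
    (h : ∀ m : ℤ, sinCoeff g m = 0) (p : Polynomial ℂ) (m : ℤ) :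
    sinCoeff (fun t => p.eval (t : ℂ) * g t) m = 0 := by
  have hc : ∀ p : Polynomial ℂ, ContinuousOn (fun t : ℝ => p.eval (t : ℂ) * g t)
      (Set.Icc (-1) 1) := fun p =>
    (by fun_prop : ContinuousOn (fun t : ℝ => p.eval (t : ℂ)) _).mul hg
  induction p using Polynomial.induction_on' with
  | add p q hp hq =>
    simp only [Polynomial.eval_add, add_mul]
    rw [sinCoeff_add (hc p) (hc q), hp, hq, add_zero]
  | monomial n c =>
    simp only [Polynomial.eval_monomial, mul_assoc]
    have := sinCoeff_pow_mul_eq_zero hg h n m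
    simp only [sinCoeff, mul_assoc, intervalIntegral.integral_const_mul] at this ⊢
    rw [mul_left_comm, this, mul_zero]

theorem norm_sinCoeff_le {g : ℝ → ℂ} (hg : ContinuousOn g (Set.Icc (-1) 1)) {C : ℝ}
    (hC : ∀ t ∈ Set.Icc (-1 : ℝ) 1, ‖g t‖ ≤ C) (m : ℤ) : ‖sinCoeff g m‖ ≤ C := by
  rw [← half_cosCoeff_sub hg]
  refine (norm_sub_le _ _).trans ?_
  have h1 := norm_cosCoeff_le hC (m - 1)
  have h2 := norm_cosCoeff_le hC (m + 1)
  simp only [norm_mul, norm_div, norm_one, Complex.norm_ofNat]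
  linarith

theorem eqOn_zero_of_sinCoeff_eq_zero {g : ℝ → ℂ} (hg : ContinuousOn g (Set.Icc (-1) 1))
    (h : ∀ m : ℤ, sinCoeff g m = 0) : Set.EqOn g (fun _ => 0) (Set.Icc (-1) 1) := by
  have hgs : ContinuousOn (fun t => (starRingEnd ℂ) (g t)) (Set.Icc (-1) 1) :=
    Complex.continuous_conj.comp_continuousOn hg
  obtain ⟨C, hC⟩ := isCompact_Icc.exists_bound_of_continuousOn hg
  have hC0 : 0 ≤ C := (norm_nonneg _).trans (hC 0 (by norm_num))
  -- The index `1` makes the weight `sin² θ`, which is positive inside the interval.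
  have hz : sinCoeff (fun t => (starRingEnd ℂ) (g t) * g t) 1 = 0 := by
    rw [← norm_le_zero_iff]
    refine le_of_forall_pos_le_add fun ε hε => ?_
    -- The denominator `C + 1` absorbs the bound on `g` and stays positive if `C = 0`.
    obtain ⟨p, hp⟩ := exists_complex_polynomial_near hgs
      (show 0 < ε / (C + 1) by positivity)
    have hpc : ContinuousOn (fun t : ℝ => p.eval (t : ℂ)) (Set.Icc (-1) 1) := by fun_prop
    have h1 := sinCoeff_add (((hgs.sub hpc).mul hg)) (hpc.mul hg) 1
    have h2 := norm_sinCoeff_le (((hgs.sub hpc).mul hg)) (C := ε) (m := 1) (by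
      intro t ht
      simp only [Pi.mul_apply, Pi.sub_apply, norm_mul]
      calc _ ≤ ε / (C + 1) * C := mul_le_mul (hp t ht) (hC t ht) (norm_nonneg _) (by positivity)
        _ ≤ ε / (C + 1) * (C + 1) := by gcongr; linarith
        _ = ε := by field_simp)
    have h3 := sinCoeff_polynomial_mul_eq_zero hg h p 1
    simp only [Pi.mul_def, Pi.sub_apply] at h1 h2
    rw [h3, add_zero] at h1
    have h4 : (fun t : ℝ => ((starRingEnd ℂ) (g t) - p.eval (t : ℂ)) * g t +
        p.eval (t : ℂ) * g t) = fun t => (starRingEnd ℂ) (g t) * g t := by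
      ext t; ring
    rw [h4] at h1
    rw [h1, zero_add]; exact h2
  have hcos := (continuousOn_comp_cos hg)
  have hr : ∫ θ in (0 : ℝ)..Real.pi, ‖g (Real.cos θ)‖ ^ 2 * Real.sin θ ^ 2 = 0 := by
    have hpi : ((1 / Real.pi : ℝ) : ℂ) ≠ 0 := by
      rw [Ne, Complex.ofReal_eq_zero]; positivity
    have h1 := (mul_eq_zero.1 hz).resolve_left hpi
    have h2 : ∀ θ : ℝ, (starRingEnd ℂ) (g (Real.cos θ)) * g (Real.cos θ) *
        ((Real.sin θ * Real.sin (((1 : ℤ) : ℝ) * θ) : ℝ) : ℂ) =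
        ((‖g (Real.cos θ)‖ ^ 2 * Real.sin θ ^ 2 : ℝ) : ℂ) := by
      intro θ
      rw [Complex.conj_mul']
      push_cast
      rw [one_mul]; ring
    simp only [h2] at h1
    rw [intervalIntegral.integral_ofReal] at h1
    exact_mod_cast h1
  have hzero : ∀ θ ∈ Set.Ioo 0 Real.pi, g (Real.cos θ) = 0 := by
    intro θ hθ
    by_contra hne
    have : 0 < ∫ θ in (0 : ℝ)..Real.pi, ‖g (Real.cos θ)‖ ^ 2 * Real.sin θ ^ 2 := by
      refine intervalIntegral.integral_pos Real.pi_pos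
        ((hcos.norm.pow 2).mul (Real.continuous_sin.pow 2)).continuousOn (fun _ _ => by positivity)
        ⟨θ, Set.Ioo_subset_Icc_self hθ, ?_⟩
      have := Real.sin_pos_of_mem_Ioo hθ
      positivity
    exact this.ne' hr
  have hIoo : Set.EqOn g (fun _ => 0) (Set.Ioo (-1) 1) := by
    intro t ht
    have := hzero (Real.arccos t) ⟨Real.arccos_pos.2 ht.2, Real.arccos_lt_pi.2 ht.1⟩
    rwa [Real.cos_arccos ht.1.le ht.2.le] at this
  exact hIoo.of_subset_closure hg continuousOn_const Set.Ioo_subset_Icc_self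
    (by rw [closure_Ioo (by norm_num)])

/-! ### Coefficients as Volterra integrals, and uniform bounds. -/

/-- The Volterra integral `∫_{-1}^τ F(τ, ρ) q(ρ) dρ`. -/
noncomputable def volterra (F : ℝ → ℝ → ℂ) (q : ℝ → ℝ) (τ : ℝ) : ℂ :=
  ∫ ρ in (-1 : ℝ)..τ, F τ ρ * (q ρ : ℂ)

section

variable {F : ℝ → ℝ → ℂ}

theorem continuousOn_section
    (hF : ContinuousOn (fun q : ℝ × ℝ => F q.1 q.2) (Set.Icc (-1 : ℝ) 1 ×ˢ Set.Icc (-1 : ℝ) 1))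
    {τ : ℝ} (hτ : τ ∈ Set.Icc (-1 : ℝ) 1) : ContinuousOn (F τ) (Set.Icc (-1) 1) :=
  hF.comp (f := fun ρ : ℝ => (τ, ρ)) (by fun_prop) fun _ hρ => ⟨hτ, hρ⟩

theorem continuousOn_diagonal
    (hF : ContinuousOn (fun q : ℝ × ℝ => F q.1 q.2) (Set.Icc (-1 : ℝ) 1 ×ˢ Set.Icc (-1 : ℝ) 1)) :
    ContinuousOn (fun t => F t t) (Set.Icc (-1) 1) :=
  hF.comp (f := fun t : ℝ => (t, t)) (by fun_prop) fun _ ht => ⟨ht, ht⟩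

theorem intervalIntegrable_volterra
    (hF : ContinuousOn (fun q : ℝ × ℝ => F q.1 q.2) (Set.Icc (-1 : ℝ) 1 ×ˢ Set.Icc (-1 : ℝ) 1))
    {q : ℝ → ℝ} (hq : Continuous q) {τ : ℝ} (hτ : τ ∈ Set.Icc (-1 : ℝ) 1) :
    IntervalIntegrable (fun ρ => F τ ρ * (q ρ : ℂ)) volume (-1) τ := by
  refine ContinuousOn.intervalIntegrable ?_
  rw [Set.uIcc_of_le hτ.1]
  exact ((continuousOn_section hF hτ).mono (Set.Icc_subset_Icc_right hτ.2)).mul (by fun_prop)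

theorem continuousOn_volterra
    (hF : ContinuousOn (fun q : ℝ × ℝ => F q.1 q.2) (Set.Icc (-1 : ℝ) 1 ×ˢ Set.Icc (-1 : ℝ) 1))
    {q : ℝ → ℝ} (hq : Continuous q) : ContinuousOn (volterra F q) (Set.Icc (-1) 1) := by
  -- Clamping to `[-1, 1]` extends `F` continuously to the plane, so that continuity of parametric
  -- integrals applies.
  let c : ℝ → ℝ := fun x => max (-1) (min x 1)
  have hc : Continuous c := by fun_prop
  have hcm : ∀ x, c x ∈ Set.Icc (-1 : ℝ) 1 := fun x =>
    ⟨le_max_left _ _, max_le (by norm_num) (min_le_right _ _)⟩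
  have hce : ∀ x ∈ Set.Icc (-1 : ℝ) 1, c x = x := fun x hx => by
    simp [c, min_eq_left hx.2, max_eq_right hx.1]
  have h1 : Continuous (Function.uncurry fun τ ρ => F (c τ) (c ρ) * (q ρ : ℂ)) := by
    refine Continuous.mul ?_ (by fun_prop)
    exact hF.comp_continuous (f := fun x : ℝ × ℝ => (c x.1, c x.2)) (by fun_prop)
      fun x => ⟨hcm _, hcm _⟩
  have h2 := intervalIntegral.continuous_parametric_intervalIntegral_of_continuous
    (μ := volume) (a₀ := -1) h1 continuous_id
  refine h2.continuousOn.congr fun τ hτ => ?_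
  refine intervalIntegral.integral_congr fun ρ hρ => ?_
  rw [Set.uIcc_of_le hτ.1] at hρ
  simp only [hce τ hτ, hce ρ ⟨hρ.1, hρ.2.trans hτ.2⟩]

theorem integral_mul_heavisideTheta {φ : ℝ → ℂ} (hφ : ContinuousOn φ (Set.Icc (-1) 1)) {τ : ℝ}
    (hτ : τ ∈ Set.Icc (-1 : ℝ) 1) :
    ∫ ρ in (-1 : ℝ)..1, φ ρ * ((heavisideTheta (τ - ρ) : ℝ) : ℂ) = ∫ ρ in (-1 : ℝ)..τ, φ ρ := by
  have e1 : Set.EqOn φ (fun ρ => φ ρ * ((heavisideTheta (τ - ρ) : ℝ) : ℂ))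
      (Set.uIoc (-1) τ) := by
    intro ρ hρ
    rw [Set.uIoc_of_le hτ.1] at hρ
    simp [heavisideTheta, not_lt.2 (sub_nonneg.2 hρ.2)]
  have e2 : Set.EqOn (fun _ => (0 : ℂ)) (fun ρ => φ ρ * ((heavisideTheta (τ - ρ) : ℝ) : ℂ))
      (Set.uIoc τ 1) := by
    intro ρ hρ
    rw [Set.uIoc_of_le hτ.2] at hρ
    simp [heavisideTheta, sub_neg.2 hρ.1]
  have i1 : IntervalIntegrable φ volume (-1) τ := by
    refine ContinuousOn.intervalIntegrable ?_
    rw [Set.uIcc_of_le hτ.1]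
    exact hφ.mono (Set.Icc_subset_Icc_right hτ.2)
  rw [← intervalIntegral.integral_add_adjacent_intervals (i1.congr e1)
    (IntervalIntegrable.congr e2 intervalIntegrable_const),
    ← intervalIntegral.integral_congr_ae (Eventually.of_forall e1),
    ← intervalIntegral.integral_congr_ae (Eventually.of_forall e2)]
  simp

theorem legendreCoeff_thetaKernel
    (hF : ContinuousOn (fun q : ℝ × ℝ => F q.1 q.2) (Set.Icc (-1 : ℝ) 1 ×ˢ Set.Icc (-1 : ℝ) 1))
    (k l : ℕ) :
    legendreCoeff (thetaKernel F) k l =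
      ∫ τ in (-1 : ℝ)..1, ((legendreOrthonormal k τ : ℝ) : ℂ) *
        volterra F (legendreOrthonormal l) τ := by
  refine intervalIntegral.integral_congr fun τ hτ => ?_
  rw [Set.uIcc_of_le (by norm_num)] at hτ
  have h := integral_mul_heavisideTheta (φ := fun ρ => ((legendreOrthonormal k τ : ℝ) : ℂ) *
    (F τ ρ * ((legendreOrthonormal l ρ : ℝ) : ℂ))) (continuousOn_const.mul
      ((continuousOn_section hF hτ).mul (continuous_legendreOrthonormal_ofReal l).continuousOn)) hτ
  rw [intervalIntegral.integral_const_mul] at h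
  simp only [volterra]
  rw [← h]
  congr 1; ext ρ
  simp only [thetaKernel]; ring

theorem integral_abs_legendreOrthonormal_le (l : ℕ) :
    ∫ t in (-1 : ℝ)..1, |legendreOrthonormal l t| ≤ 3 := by
  have cl := continuous_legendreOrthonormal l
  have h2 := integral_legendreOrthonormal_mul l l
  rw [if_pos rfl] at h2
  -- The integrand dominates `|p_l|`, and its integral is `2 + 1` by normalisation.
  have h3 : ∫ t in (-1 : ℝ)..1, 1 + (legendreOrthonormal l t * legendreOrthonormal l t) = 3 := by
    rw [intervalIntegral.integral_add (Continuous.intervalIntegrable (by fun_prop) _ _)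
      (Continuous.intervalIntegrable (by fun_prop) _ _), h2]
    norm_num
  refine le_trans (intervalIntegral.integral_mono_on (by norm_num) ?_ ?_ fun t _ => ?_) h3.le
  · exact Continuous.intervalIntegrable (by fun_prop) _ _
  · exact Continuous.intervalIntegrable (by fun_prop) _ _
  nlinarith [sq_nonneg (|legendreOrthonormal l t| - 1),
    abs_mul_abs_self (legendreOrthonormal l t)]

theorem norm_legendreCoeff_thetaKernel_le
    (hF : ContinuousOn (fun q : ℝ × ℝ => F q.1 q.2) (Set.Icc (-1 : ℝ) 1 ×ˢ Set.Icc (-1 : ℝ) 1)) :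
    ∃ C, 0 ≤ C ∧ ∀ k l, ‖legendreCoeff (thetaKernel F) k l‖ ≤ C := by
  obtain ⟨C, hC⟩ := (isCompact_Icc.prod isCompact_Icc).exists_bound_of_continuousOn hF
  have hC0 : 0 ≤ C := (norm_nonneg _).trans (hC (0, 0) (by constructor <;> norm_num))
  refine ⟨C * 3 * 3, by positivity, fun k l => ?_⟩
  have ck := continuous_legendreOrthonormal k
  have cl := continuous_legendreOrthonormal l
  rw [legendreCoeff_thetaKernel hF]
  have hv : ∀ τ ∈ Set.Icc (-1 : ℝ) 1, ‖volterra F (legendreOrthonormal l) τ‖ ≤ C * 3 := by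
    intro τ hτ
    have h1 : ‖volterra F (legendreOrthonormal l) τ‖ ≤
        ∫ ρ in (-1 : ℝ)..τ, C * |legendreOrthonormal l ρ| := by
      refine intervalIntegral.norm_integral_le_of_norm_le hτ.1 ?_
        (Continuous.intervalIntegrable (by fun_prop) _ _)
      refine Eventually.of_forall fun ρ hρ => ?_
      rw [norm_mul, Complex.norm_real]
      exact mul_le_mul_of_nonneg_right (hC (τ, ρ) ⟨hτ, hρ.1.le, hρ.2.trans hτ.2⟩) (abs_nonneg _)
    refine h1.trans ?_
    rw [intervalIntegral.integral_const_mul]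
    refine mul_le_mul_of_nonneg_left (le_trans ?_ (integral_abs_legendreOrthonormal_le l)) hC0
    exact intervalIntegral.integral_mono_interval le_rfl hτ.1 hτ.2
      (Eventually.of_forall fun _ => abs_nonneg _)
      (Continuous.intervalIntegrable (by fun_prop) _ _)
  have h1 : ‖∫ τ in (-1 : ℝ)..1, ((legendreOrthonormal k τ : ℝ) : ℂ) *
        volterra F (legendreOrthonormal l) τ‖ ≤
      ∫ τ in (-1 : ℝ)..1, C * 3 * |legendreOrthonormal k τ| := by
    refine intervalIntegral.norm_integral_le_of_norm_le (by norm_num) ?_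
      (Continuous.intervalIntegrable (by fun_prop) _ _)
    refine Eventually.of_forall fun τ hτ => ?_
    rw [norm_mul, Complex.norm_real, mul_comm]
    exact mul_le_mul_of_nonneg_right (hv τ (Set.Ioc_subset_Icc_self hτ)) (abs_nonneg _)
  refine h1.trans ?_
  rw [intervalIntegral.integral_const_mul]
  exact mul_le_mul_of_nonneg_left (integral_abs_legendreOrthonormal_le k) (by positivity)

/-! ### Integration by parts and the diagonal limits. -/

/-- The partial derivative of `F` in its second variable. -/
noncomputable def partialSnd (F : ℝ → ℝ → ℂ) (t s : ℝ) : ℂ :=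
  fderiv ℝ (fun q : ℝ × ℝ => F q.1 q.2) (t, s) (0, 1)

theorem analyticOnNhd_partialSnd {S : Set (ℝ × ℝ)}
    (hF : AnalyticOnNhd ℝ (fun q : ℝ × ℝ => F q.1 q.2) S) :
    AnalyticOnNhd ℝ (fun q : ℝ × ℝ => partialSnd F q.1 q.2) S :=
  (ContinuousLinearMap.apply ℝ ℂ ((0, 1) : ℝ × ℝ)).comp_analyticOnNhd hF.fderiv

theorem hasDerivAt_partialSnd {t s : ℝ}
    (hF : AnalyticAt ℝ (fun q : ℝ × ℝ => F q.1 q.2) (t, s)) :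
    HasDerivAt (F t) (partialSnd F t s) s :=
  hF.differentiableAt.hasFDerivAt.comp_hasDerivAt (f := fun s => (t, s)) s
    ((hasDerivAt_const s t).prodMk (hasDerivAt_id s))

theorem volterra_legendreOrthonormal_succ
    (hF : AnalyticOnNhd ℝ (fun q : ℝ × ℝ => F q.1 q.2)
      (Set.Icc (-1 : ℝ) 1 ×ˢ Set.Icc (-1 : ℝ) 1)) (n : ℕ) {τ : ℝ}
    (hτ : τ ∈ Set.Icc (-1 : ℝ) 1) :
    volterra F (legendreOrthonormal (n + 1)) τ =
      legendreAnti (n + 1) * (F τ τ * legendreOrthonormal (n + 2) τ -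
        volterra (partialSnd F) (legendreOrthonormal (n + 2)) τ) -
      legendreAnti n * (F τ τ * legendreOrthonormal n τ -
        volterra (partialSnd F) (legendreOrthonormal n) τ) := by
  have hG := (analyticOnNhd_partialSnd hF).continuousOn
  have i1 := intervalIntegrable_volterra hG (continuous_legendreOrthonormal (n + 2)) hτ
  have i0 := intervalIntegrable_volterra hG (continuous_legendreOrthonormal n) hτ
  have hsub : ∀ ρ ∈ Set.uIcc (-1) τ, ρ ∈ Set.Icc (-1 : ℝ) 1 := by
    intro ρ hρ
    rw [Set.uIcc_of_le hτ.1] at hρ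
    exact ⟨hρ.1, hρ.2.trans hτ.2⟩
  have ig : IntervalIntegrable (partialSnd F τ) volume (-1) τ :=
    ContinuousOn.intervalIntegrable ((continuousOn_section hG hτ).mono hsub)
  have hparts := intervalIntegral.integral_mul_deriv_eq_deriv_mul
    (fun ρ hρ => hasDerivAt_partialSnd (hF (τ, ρ) ⟨hτ, hsub ρ hρ⟩))
    (fun ρ _ => (hasDerivAt_legendreOrthonormal_sub n ρ).ofReal_comp) ig
    ((continuous_legendreOrthonormal_ofReal (n + 1)).intervalIntegrable _ _)
  rw [legendreOrthonormal_sub_neg_one] at hparts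
  have hsplit : ∫ ρ in (-1 : ℝ)..τ, partialSnd F τ ρ *
      ((legendreAnti (n + 1) * legendreOrthonormal (n + 2) ρ -
        legendreAnti n * legendreOrthonormal n ρ : ℝ) : ℂ) =
      legendreAnti (n + 1) * volterra (partialSnd F) (legendreOrthonormal (n + 2)) τ -
      legendreAnti n * volterra (partialSnd F) (legendreOrthonormal n) τ := by
    simp only [volterra]
    rw [← intervalIntegral.integral_const_mul, ← intervalIntegral.integral_const_mul,
      ← intervalIntegral.integral_sub (i1.const_mul _) (i0.const_mul _)]
    congr 1; ext ρ
    push_cast; ring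
  rw [hsplit] at hparts
  rw [volterra, hparts]
  push_cast; ring

theorem legendreCoeff_thetaKernel_succ
    (hF : AnalyticOnNhd ℝ (fun q : ℝ × ℝ => F q.1 q.2)
      (Set.Icc (-1 : ℝ) 1 ×ˢ Set.Icc (-1 : ℝ) 1)) (k n : ℕ) :
    legendreCoeff (thetaKernel F) k (n + 1) =
      legendreAnti (n + 1) * (legendreMoment (fun t => F t t) k (n + 2) -
        legendreCoeff (thetaKernel (partialSnd F)) k (n + 2)) -
      legendreAnti n * (legendreMoment (fun t => F t t) k n -
        legendreCoeff (thetaKernel (partialSnd F)) k n) := by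
  have hG := (analyticOnNhd_partialSnd hF).continuousOn
  have hd := continuousOn_diagonal hF.continuousOn
  have iM := fun l => intervalIntegrable_of_continuousOn_Icc (continuousOn_legendreMoment hd k l)
  have iV : ∀ l, IntervalIntegrable (fun τ => ((legendreOrthonormal k τ : ℝ) : ℂ) *
      volterra (partialSnd F) (legendreOrthonormal l) τ) volume (-1) 1 := fun l =>
    intervalIntegrable_of_continuousOn_Icc
    ((continuous_legendreOrthonormal_ofReal k).continuousOn.mul
      (continuousOn_volterra hG (continuous_legendreOrthonormal l)))
  rw [legendreCoeff_thetaKernel hF.continuousOn, legendreCoeff_thetaKernel hG,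
    legendreCoeff_thetaKernel hG, legendreMoment, legendreMoment,
    ← intervalIntegral.integral_sub (iM _) (iV _), ← intervalIntegral.integral_sub (iM _) (iV _),
    ← intervalIntegral.integral_const_mul, ← intervalIntegral.integral_const_mul,
    ← intervalIntegral.integral_sub (((iM _).sub (iV _)).const_mul _)
      (((iM _).sub (iV _)).const_mul _)]
  refine intervalIntegral.integral_congr fun τ hτ => ?_
  rw [Set.uIcc_of_le (by norm_num)] at hτ
  simp only [volterra_legendreOrthonormal_succ hF n hτ]
  ring

theorem tendsto_legendreAnti_snd (m : ℤ) :
    Tendsto (fun q : ℕ × ℕ => legendreAnti q.2) (alongIntDiagonal m) (𝓝 0) :=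
  tendsto_legendreAnti.comp (tendsto_snd_alongIntDiagonal m)

theorem legendreAnti_nonneg (n : ℕ) : 0 ≤ legendreAnti n := by
  unfold legendreAnti; positivity

/-- One integration by parts yields factors `legendreAnti`, which tend to zero, times uniformly
bounded quantities. -/
theorem tendsto_legendreCoeff_zero
    (hF : AnalyticOnNhd ℝ (fun q : ℝ × ℝ => F q.1 q.2)
      (Set.Icc (-1 : ℝ) 1 ×ˢ Set.Icc (-1 : ℝ) 1)) (m : ℤ) :
    Tendsto (fun q : ℕ × ℕ => legendreCoeff (thetaKernel F) q.1 q.2) (alongIntDiagonal m)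
      (𝓝 0) := by
  have hG := (analyticOnNhd_partialSnd hF).continuousOn
  obtain ⟨C, hC0, hC⟩ := norm_legendreCoeff_thetaKernel_le hG
  obtain ⟨D, hD⟩ := isCompact_Icc.exists_bound_of_continuousOn
    (continuousOn_diagonal hF.continuousOn)
  have hb : ∀ k l, ‖legendreMoment (fun t => F t t) k l -
      legendreCoeff (thetaKernel (partialSnd F)) k l‖ ≤ D + C := fun k l =>
    (norm_sub_le _ _).trans (add_le_add (norm_legendreMoment_le hD k l) (hC k l))
  have h0 := ((tendsto_legendreAnti_snd m).mul_const (D + C)).add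
    (((tendsto_legendreAnti_snd (m + 1)).comp (tendsto_pred_alongIntDiagonal m)).mul_const (D + C))
  simp only [zero_mul, add_zero] at h0
  refine squeeze_zero_norm' ?_ h0
  filter_upwards [(tendsto_snd_alongIntDiagonal m).eventually (eventually_ge_atTop 1)] with q hq
  obtain ⟨k, l⟩ := q
  obtain ⟨l, rfl⟩ := Nat.exists_eq_add_of_le' hq
  simp only [Function.comp_apply, Nat.add_sub_cancel]
  rw [legendreCoeff_thetaKernel_succ hF]
  refine (norm_sub_le _ _).trans (add_le_add ?_ ?_) <;>
  · rw [norm_mul, Complex.norm_real, Real.norm_of_nonneg (legendreAnti_nonneg _)]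
    exact mul_le_mul_of_nonneg_left (hb _ _) (legendreAnti_nonneg _)

theorem tendsto_mul_legendreAnti : Tendsto (fun n : ℕ => (n : ℝ) * legendreAnti n) atTop
    (𝓝 (1 / 2)) := by
  have h := tendsto_legendreJacobi.sub tendsto_legendreAnti
  rw [sub_zero] at h
  refine h.congr fun n => ?_
  rw [← legendreAnti_eq]; ring

theorem tendsto_mul_legendreCoeff
    (hF : AnalyticOnNhd ℝ (fun q : ℝ × ℝ => F q.1 q.2)
      (Set.Icc (-1 : ℝ) 1 ×ˢ Set.Icc (-1 : ℝ) 1)) (m : ℤ) :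
    Tendsto (fun q : ℕ × ℕ => (q.2 : ℂ) * legendreCoeff (thetaKernel F) q.1 q.2)
      (alongIntDiagonal m) (𝓝 (sinCoeff (fun t => F t t) m)) := by
  have hd := continuousOn_diagonal hF.continuousOn
  have hR : ∀ m, Tendsto (fun q : ℕ × ℕ => legendreMoment (fun t => F t t) q.1 q.2 -
      legendreCoeff (thetaKernel (partialSnd F)) q.1 q.2) (alongIntDiagonal m)
      (𝓝 (cosCoeff (fun t => F t t) m)) := fun m => by
    have := (tendsto_legendreMoment hd m).sub
      (tendsto_legendreCoeff_zero (analyticOnNhd_partialSnd hF) m)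
    rwa [sub_zero] at this
  have hA : Tendsto (fun q : ℕ × ℕ => ((q.2 * legendreAnti q.2 : ℝ) : ℂ)) (alongIntDiagonal m)
      (𝓝 (1 / 2)) := by
    have := (Complex.continuous_ofReal.tendsto _).comp
      (tendsto_mul_legendreAnti.comp (tendsto_snd_alongIntDiagonal m))
    simpa [Function.comp_def] using this
  have hB : Tendsto (fun q : ℕ × ℕ => ((legendreJacobi (q.2 - 1) : ℝ) : ℂ)) (alongIntDiagonal m)
      (𝓝 (1 / 2)) := tendsto_legendreJacobi_pred m
  have h1 := hA.mul ((hR (m - 1)).comp (tendsto_succ_alongIntDiagonal m))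
  have h2 := hB.mul ((hR (m + 1)).comp (tendsto_pred_alongIntDiagonal m))
  rw [← half_cosCoeff_sub hd]
  refine (h1.sub h2).congr' ?_
  filter_upwards [(tendsto_snd_alongIntDiagonal m).eventually (eventually_ge_atTop 1)] with q hq
  obtain ⟨k, l⟩ := q
  obtain ⟨l, rfl⟩ := Nat.exists_eq_add_of_le' hq
  simp only [Function.comp_apply, Nat.add_sub_cancel]
  -- After writing `ℓ = l + 1`, the lower weight `(l + 1) * legendreAnti l` is exactly
  -- `legendreJacobi l`.
  rw [legendreCoeff_thetaKernel_succ hF, ← legendreAnti_eq]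
  push_cast; ring

theorem tendsto_mul_norm_legendreCoeff
    (hF : AnalyticOnNhd ℝ (fun q : ℝ × ℝ => F q.1 q.2)
      (Set.Icc (-1 : ℝ) 1 ×ˢ Set.Icc (-1 : ℝ) 1)) (a : ℕ) :
    Tendsto (fun q : ℕ × ℕ => (q.2 : ℝ) * ‖legendreCoeff (thetaKernel F) q.1 q.2‖)
      (alongDiagonal a) (𝓝 ‖sinCoeff (fun t => F t t) a‖) := by
  refine Tendsto.mono_left (tendsto_sup.2 ⟨?_, ?_⟩) (alongDiagonal_le a)
  · simpa using (tendsto_mul_legendreCoeff hF a).norm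
  · simpa [sinCoeff_neg] using (tendsto_mul_legendreCoeff hF (-a)).norm

end

/-! ### The theorem. -/

theorem mainTheorem9 (F : ℝ → ℝ → ℂ)
    (hF : AnalyticOnNhd ℝ (fun q : ℝ × ℝ => F q.1 q.2)
      (Set.Icc (-1 : ℝ) 1 ×ˢ Set.Icc (-1 : ℝ) 1)) :
    (∀ a : ℕ,
      (fun q : ℕ × ℕ => legendreCoeff (thetaKernel F) q.1 q.2)
        =O[alongDiagonal a] (fun q : ℕ × ℕ => 1 / (q.2 : ℝ))) ∧
    ∃ c : ℕ → ℝ,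
      (∀ a : ℕ,
        Tendsto (fun q : ℕ × ℕ => (q.2 : ℝ) * ‖legendreCoeff (thetaKernel F) q.1 q.2‖)
          (alongDiagonal a) (𝓝 (c a))) ∧
      ((∃ t ∈ Set.Icc (-1 : ℝ) 1, F t t ≠ 0) → ∃ a : ℕ, 0 < c a) := by
  refine ⟨fun a => ?_, fun a => ‖sinCoeff (fun t => F t t) a‖,
    tendsto_mul_norm_legendreCoeff hF, ?_⟩
  · have h := tendsto_mul_norm_legendreCoeff hF a
    refine IsBigO.of_bound (‖sinCoeff (fun t => F t t) a‖ + 1) ?_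
    have hpos : ∀ᶠ q : ℕ × ℕ in alongDiagonal a, 1 ≤ q.2 :=
      (tendsto_snd.mono_left inf_le_left).eventually (eventually_ge_atTop 1)
    filter_upwards [h.eventually (eventually_le_nhds (lt_add_one _)), hpos] with q hq hq1
    have h1 : (0 : ℝ) < q.2 := by exact_mod_cast hq1
    rw [Real.norm_of_nonneg (by positivity), mul_one_div, le_div_iff₀ h1, mul_comm]
    exact hq
  · rintro ⟨t, ht, hne⟩
    by_contra! hcon
    refine hne (eqOn_zero_of_sinCoeff_eq_zero (continuousOn_diagonal hF.continuousOn) ?_ ht)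
    intro m
    -- The assumption covers `m ≥ 0` only; oddness gives the rest.
    obtain ⟨a, rfl | rfl⟩ := m.eq_nat_or_neg
    · exact norm_le_zero_iff.1 (hcon a)
    · rw [sinCoeff_neg, norm_le_zero_iff.1 (hcon a), neg_zero]
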